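/- Let $A$ be a unital $C^*$-algebra with a faithful state $\varphi$ (a positive linear functional with $\varphi(1)=1$ such that $\varphi(a^*a)=0$ implies $a=0$). Let $(A_i)_{i\in I}$ be a family of norm-closed $*$-subalgebras of $A$ containing the unit of $A$ that is free with respect to $\varphi$, that is, $\varphi(b_1b_2\cdots b_n)=0$ whenever $n\ge 1$, $b_k\in A_{i_k}$, $\varphi(b_k)=0$ for $1\le k\le n$, and $i_k\neq i_{k+1}$ for $1\le k<n$. Let $\delta>0$ and let $x_i\in A_i$ ($i\in I$) satisfy $$\|x_i\|\le 1,\qquad \varphi(x_i)=0,\qquad \min\{\varphi(x_i^*x_i),\varphi(x_ix_i^*)\}\ge\delta^2\qquad\text{for all } i\in I.$$ Then for every complex Hilbert space $H$ and every finitely supported family $(a_i)_{i\in I}$ in $B(H)$, $$\delta\max\Big\{\Big\|\sum_i a_i^*a_i\Big\|^{1/2},\Big\|\sum_i a_ia_i^*\Big\|^{1/2}\Big\}\le\Big\|\sum_i x_i\otimes a_i\Big\|\le 2\max\Big\{\Big\|\sum_i a_i^*a_i\Big\|^{1/2},\Big\|\sum_i a_ia_i^*\Big\|^{1/2}\Big\},$$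 where the norm in the middle is the minimal (spatial) tensor norm on $A\otimes B(H)$: for every faithful unital $*$-representation $\pi\colon A\to B(K)$ on a complex Hilbert space $K$, it is the norm of $\sum_i\pi(x_i)\otimes a_i$ as an operator on the Hilbert space tensor product $K\otimes_2 H$. -/

import Mathlib

open scoped ComplexOrder TensorProduct

noncomputable section

/-- The positive linear functional `φ` on a unital C*-algebra is a faithful state. -/
structure IsFaithfulState {A : Type*} [CStarAlgebra A] [PartialOrder A] [StarOrderedRing A]
    (φ : A →ₚ[ℂ] ℂ) : Prop where
  map_one : φ 1 = 1
  faithful : ∀ a : A, φ (star a * a) = 0 → a = 0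

/-- Voiculescu's freeness of a family of unital subalgebras with respect to `φ`:
`φ (b₁ b₂ ⋯ bₙ) = 0` whenever `n ≥ 1`, `bₖ ∈ 𝒜 (iₖ)`, `φ bₖ = 0` for every `k`, and
neighbouring indices are different, `i₁ ≠ i₂ ≠ ⋯ ≠ iₙ`.
The word is encoded as the nonempty list of the pairs `(iₖ, bₖ)`. -/
def IsFreeFamily {I A : Type*} [CStarAlgebra A] [PartialOrder A] [StarOrderedRing A]
    (φ : A →ₚ[ℂ] ℂ) (𝒜 : I → StarSubalgebra ℂ A) : Prop :=
  ∀ w : List (I × A), w ≠ [] →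
    (∀ p ∈ w, p.2 ∈ 𝒜 p.1 ∧ φ p.2 = 0) →
    w.IsChain (fun p q => p.1 ≠ q.1) →
    φ (w.map Prod.snd).prod = 0

/-- The Hilbert space tensor product: the completion of the algebraic tensor product for the
inner product with `⟪k ⊗ h, k' ⊗ h'⟫ = ⟪k, k'⟫ ⟪h, h'⟫`. -/
abbrev HilbertTensor (K H : Type*) [NormedAddCommGroup K] [InnerProductSpace ℂ K]
    [NormedAddCommGroup H] [InnerProductSpace ℂ H] : Type _ :=
  UniformSpace.Completion (K ⊗[ℂ] H)

/-- The bounded operator `S ⊗ T` on the Hilbert space tensor product, the continuous extension of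
`k ⊗ h ↦ S k ⊗ T h`. -/
def tensorOp {K H : Type*} [NormedAddCommGroup K] [InnerProductSpace ℂ K]
    [NormedAddCommGroup H] [InnerProductSpace ℂ H] (S : K →L[ℂ] K) (T : H →L[ℂ] H) :
    HilbertTensor K H →L[ℂ] HilbertTensor K H :=
  (TensorProduct.mapL S T).completion

theorem tensorOp_coe_tmul {K H : Type*} [NormedAddCommGroup K] [InnerProductSpace ℂ K]
    [NormedAddCommGroup H] [InnerProductSpace ℂ H] (S : K →L[ℂ] K) (T : H →L[ℂ] H)
    (k : K) (h : H) :
    tensorOp S T ((k ⊗ₜ[ℂ] h : K ⊗[ℂ] H) : HilbertTensor K H) =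
      ((S k ⊗ₜ[ℂ] T h : K ⊗[ℂ] H) : HilbertTensor K H) := by
  simp [tensorOp]

end

/-! ### Calculus of elementary tensor operators on the Hilbert tensor product. -/

section TensorOp

variable {K H : Type*} [NormedAddCommGroup K] [InnerProductSpace ℂ K]
  [NormedAddCommGroup H] [InnerProductSpace ℂ H]

/-! The minimal norm may be computed in any faithful representation
(`norm_sum_tensorOp_le_of_injective`), so after restriction to the C*-algebra generated by the `𝒜 i`
the GNS representation of `φ`, with cyclic vector Ω, can be used.

Upper bound: let `P i` project onto the closed span of the alternating words starting in `𝒜 i`.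
Freeness makes the `P i` mutually orthogonal. A centred `x i` prolongs every word not starting in `𝒜
i` to one that does, so `x i * (1 - P i)` has range in that of `P i`
(`gnsStarAlgHom_mul_one_sub_starProjection`). In `x i = x i * P i + P i * x i * (1 - P i)` the first
terms satisfy `∑ S* S ≤ 1` and the second `∑ S S* ≤ 1`. Cauchy–Schwarz bounds the two sums by the
row and the column norm of `a` (`norm_sum_tensorOp_le_row_add_column`), whence the factor 2.

Lower bound: the vectors `x i Ω` are orthogonal with norm at least δ, so testing on Ω ⊗ v gives the
column norm (`mul_sqrt_norm_sum_star_mul_le`); passing to adjoints gives the row norm. -/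

theorem HilbertTensor.induction_tmul {p : HilbertTensor K H → Prop}
    (hclosed : IsClosed {x | p x})
    (hadd : ∀ x y, p x → p y → p (x + y)) (hzero : p 0)
    (htmul : ∀ (k : K) (h : H), p ((k ⊗ₜ[ℂ] h : K ⊗[ℂ] H) : HilbertTensor K H))
    (x : HilbertTensor K H) : p x := by
  induction x using UniformSpace.Completion.induction_on with
  | hp => exact hclosed
  | ih x =>
    induction x using TensorProduct.induction_on with
    | zero => exact UniformSpace.Completion.coe_zero (α := K ⊗[ℂ] H) ▸ hzero
    | tmul k h => exact htmul k h
    | add x y hx hy => simpa [UniformSpace.Completion.coe_add] using hadd _ _ hx hy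

theorem HilbertTensor.ext_tmul {E : Type*} [NormedAddCommGroup E] [NormedSpace ℂ E]
    {f g : HilbertTensor K H →L[ℂ] E}
    (h : ∀ (k : K) (h : H), f ((k ⊗ₜ[ℂ] h : K ⊗[ℂ] H) : HilbertTensor K H) =
      g ((k ⊗ₜ[ℂ] h : K ⊗[ℂ] H) : HilbertTensor K H)) : f = g := by
  ext x
  induction x using HilbertTensor.induction_tmul with
  | hclosed => exact isClosed_eq f.continuous g.continuous
  | hadd x y hx hy => simp [hx, hy]
  | hzero => simp
  | htmul k t => exact h k t

theorem tensorOp_mul (S S' : K →L[ℂ] K) (T T' : H →L[ℂ] H) :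
    tensorOp S T * tensorOp S' T' = tensorOp (S * S') (T * T') :=
  HilbertTensor.ext_tmul fun k h => by simp [tensorOp_coe_tmul]

theorem tensorOp_add_left (S S' : K →L[ℂ] K) (T : H →L[ℂ] H) :
    tensorOp (S + S') T = tensorOp S T + tensorOp S' T :=
  HilbertTensor.ext_tmul fun k h => by
    simp [tensorOp_coe_tmul, TensorProduct.add_tmul, UniformSpace.Completion.coe_add]

theorem tensorOp_add_right (S : K →L[ℂ] K) (T T' : H →L[ℂ] H) :
    tensorOp S (T + T') = tensorOp S T + tensorOp S T' :=
  HilbertTensor.ext_tmul fun k h => by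
    simp [tensorOp_coe_tmul, TensorProduct.tmul_add, UniformSpace.Completion.coe_add]

theorem tensorOp_smul_left (c : ℂ) (S : K →L[ℂ] K) (T : H →L[ℂ] H) :
    tensorOp (c • S) T = c • tensorOp S T :=
  HilbertTensor.ext_tmul fun k h => by
    simp [tensorOp_coe_tmul, ← TensorProduct.smul_tmul', UniformSpace.Completion.coe_smul]

theorem tensorOp_smul_right (c : ℂ) (S : K →L[ℂ] K) (T : H →L[ℂ] H) :
    tensorOp S (c • T) = c • tensorOp S T :=
  HilbertTensor.ext_tmul fun k h => by
    simp [tensorOp_coe_tmul, TensorProduct.tmul_smul, UniformSpace.Completion.coe_smul]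

@[simp]
theorem tensorOp_zero_left (T : H →L[ℂ] H) : tensorOp (0 : K →L[ℂ] K) T = 0 := by
  simpa using tensorOp_smul_left 0 (0 : K →L[ℂ] K) T

@[simp]
theorem tensorOp_zero_right (S : K →L[ℂ] K) : tensorOp S (0 : H →L[ℂ] H) = 0 := by
  simpa using tensorOp_smul_right 0 S (0 : H →L[ℂ] H)

theorem tensorOp_sum_left {ι : Type*} (s : Finset ι) (S : ι → K →L[ℂ] K) (T : H →L[ℂ] H) :
    tensorOp (∑ i ∈ s, S i) T = ∑ i ∈ s, tensorOp (S i) T := by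
  classical
  induction s using Finset.induction_on with
  | empty => simp
  | insert i s hi ih => rw [Finset.sum_insert hi, Finset.sum_insert hi, tensorOp_add_left, ih]

theorem tensorOp_sum_right {ι : Type*} (s : Finset ι) (S : K →L[ℂ] K) (T : ι → H →L[ℂ] H) :
    tensorOp S (∑ i ∈ s, T i) = ∑ i ∈ s, tensorOp S (T i) := by
  classical
  induction s using Finset.induction_on with
  | empty => simp
  | insert i s hi ih => rw [Finset.sum_insert hi, Finset.sum_insert hi, tensorOp_add_right, ih]

theorem inner_tensorOp_tmul (S : K →L[ℂ] K) (T : H →L[ℂ] H) (k k' : K) (h h' : H) :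
    inner ℂ ((k ⊗ₜ[ℂ] h : K ⊗[ℂ] H) : HilbertTensor K H)
      (tensorOp S T ((k' ⊗ₜ[ℂ] h' : K ⊗[ℂ] H) : HilbertTensor K H)) =
      inner ℂ k (S k') * inner ℂ h (T h') := by
  rw [tensorOp_coe_tmul, UniformSpace.Completion.inner_coe, TensorProduct.inner_tmul]

theorem norm_tensorOp_le (S : K →L[ℂ] K) (T : H →L[ℂ] H) : ‖tensorOp S T‖ ≤ ‖S‖ * ‖T‖ := by
  refine ContinuousLinearMap.opNorm_le_bound _ (by positivity) fun x => ?_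
  induction x using UniformSpace.Completion.induction_on with
  | hp => exact isClosed_le (by fun_prop) (by fun_prop)
  | ih x =>
    rw [tensorOp, ContinuousLinearMap.completion_apply_coe, UniformSpace.Completion.norm_coe,
      UniformSpace.Completion.norm_coe]
    exact ((TensorProduct.mapL S T).le_opNorm x).trans (by
      gcongr; exact TensorProduct.norm_mapL_le S T)

theorem star_tensorOp [CompleteSpace K] [CompleteSpace H] (S : K →L[ℂ] K) (T : H →L[ℂ] H) :
    star (tensorOp S T) = tensorOp (star S) (star T) := by
  symm
  rw [ContinuousLinearMap.star_eq_adjoint (tensorOp S T), ContinuousLinearMap.eq_adjoint_iff]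
  intro x y
  induction x using HilbertTensor.induction_tmul with
  | hclosed => exact isClosed_eq (by fun_prop) (by fun_prop)
  | hadd x x' hx hx' => simp [inner_add_left, hx, hx']
  | hzero => simp
  | htmul k h =>
    induction y using HilbertTensor.induction_tmul with
    | hclosed => exact isClosed_eq (by fun_prop) (by fun_prop)
    | hadd x x' hx hx' => simp [inner_add_right, hx, hx']
    | hzero => simp
    | htmul k' h' =>
      rw [inner_tensorOp_tmul, tensorOp_coe_tmul, UniformSpace.Completion.inner_coe,
        TensorProduct.inner_tmul, ContinuousLinearMap.star_eq_adjoint,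
        ContinuousLinearMap.star_eq_adjoint, ContinuousLinearMap.adjoint_inner_left,
        ContinuousLinearMap.adjoint_inner_left]

end TensorOp

/-- Cauchy–Schwarz in the Hilbert C*-module of `s`-tuples over `B`. -/
theorem norm_sum_star_mul_le {ι B : Type*} [CStarAlgebra B] (s : Finset ι) (x y : ι → B) :
    ‖∑ i ∈ s, star (x i) * y i‖ ≤
      √‖∑ i ∈ s, star (x i) * x i‖ * √‖∑ i ∈ s, star (y i) * y i‖ := by
  let _ : PartialOrder B := CStarAlgebra.spectralOrder B
  have _ : StarOrderedRing B := CStarAlgebra.spectralOrderedRing B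
  -- The inner product on `B` as a module over itself is `y * star x`, so the tuples enter starred
  -- and in swapped order.
  have h := CStarModule.norm_inner_le (A := B) (WithCStarModule B (s → B))
    (x := (WithCStarModule.equiv B (s → B)).symm fun i => star (y i))
    (y := (WithCStarModule.equiv B (s → B)).symm fun i => star (x i))
  rw [WithCStarModule.pi_norm, WithCStarModule.pi_norm, WithCStarModule.pi_inner] at h
  simp only [WithCStarModule.inner_def, WithCStarModule.equiv_symm_pi_apply, star_star] at h
  rw [mul_comm] at h
  simpa only [Finset.sum_coe_sort s (fun i => star (x i) * y i),
    Finset.sum_coe_sort s (fun i => star (x i) * x i),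
    Finset.sum_coe_sort s (fun i => star (y i) * y i)] using h

/-! ### Independence of the minimal norm from the faithful representation. -/

section FaithfulRepresentations

open InnerProductSpace

variable {A K K' H : Type*} [CStarAlgebra A]
  [NormedAddCommGroup H] [InnerProductSpace ℂ H] [CompleteSpace H]
  [NormedAddCommGroup K] [InnerProductSpace ℂ K] [CompleteSpace K]
  [NormedAddCommGroup K'] [InnerProductSpace ℂ K'] [CompleteSpace K']

/-- The amplification `[bₖₗ] ↦ ∑ₖₗ π bₖₗ ⊗ |eₖ⟩⟨eₗ|` of a representation of `A` to matrices over
`A`, for an orthonormal family `e`. -/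
noncomputable def matrixTensorHom {n : Type*} [Fintype n] (π : A →⋆ₐ[ℂ] (K →L[ℂ] K)) (e : n → H)
    (he : Orthonormal ℂ e) :
    CStarMatrix n n A →⋆ₙₐ[ℂ] (HilbertTensor K H →L[ℂ] HilbertTensor K H) where
  toFun M := ∑ k, ∑ l, tensorOp (π (M k l)) (rankOne ℂ (e k) (e l))
  map_smul' c M := by
    simp [Finset.smul_sum, tensorOp_smul_left]
  map_zero' := by simp
  map_add' M N := by
    simp [Finset.sum_add_distrib, tensorOp_add_left]
  map_mul' M N := by
    classical
    have hE (k l k' l' : n) : rankOne ℂ (e k) (e l) * rankOne ℂ (e k') (e l') =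
        if l = k' then rankOne ℂ (e k) (e l') else 0 := by
      rw [ContinuousLinearMap.mul_def, rankOne_comp_rankOne, orthonormal_iff_ite.1 he]
      split_ifs <;> simp
    have h0 (c : Prop) [Decidable c] (S : K →L[ℂ] K) (T : H →L[ℂ] H) :
        tensorOp S (if c then T else 0) = if c then tensorOp S T else 0 := by
      split_ifs <;> simp
    simp only [Finset.sum_mul, CStarMatrix.mul_apply, map_sum, map_mul, tensorOp_sum_left]
    refine Finset.sum_congr rfl fun k _ => ?_
    rw [Finset.sum_comm]
    refine Finset.sum_congr rfl fun l _ => ?_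
    simp only [Finset.mul_sum, tensorOp_mul, hE, h0]
    rw [Finset.sum_comm]
    simp
  map_star' M := by
    rw [Finset.sum_comm]
    refine Eq.symm ((star_sum (R := HilbertTensor K H →L[ℂ] HilbertTensor K H) _ _).trans
      (Finset.sum_congr rfl fun l _ =>
      (star_sum (R := HilbertTensor K H →L[ℂ] HilbertTensor K H) _ _).trans
      (Finset.sum_congr rfl fun k _ => ?_)))
    rw [star_tensorOp, ContinuousLinearMap.star_eq_adjoint (rankOne ℂ (e l) (e k)),
      adjoint_rankOne, CStarMatrix.star_apply, map_star]

theorem matrixTensorHom_apply {n : Type*} [Fintype n] (π : A →⋆ₐ[ℂ] (K →L[ℂ] K)) (e : n → H)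
    (he : Orthonormal ℂ e) (M : CStarMatrix n n A) :
    matrixTensorHom π e he M = ∑ k, ∑ l, tensorOp (π (M k l)) (rankOne ℂ (e k) (e l)) := rfl

/-- The entries of `M` are recovered from the coefficients between `u ⊗ e k` and `v ⊗ e l`, which
equal `⟪u, π (M k l) v⟫`. -/
theorem matrixTensorHom_injective {n : Type*} [Fintype n] {π : A →⋆ₐ[ℂ] (K →L[ℂ] K)}
    (hπ : Function.Injective π) {e : n → H} (he : Orthonormal ℂ e) :
    Function.Injective (matrixTensorHom π e he) := by
  classical
  rw [injective_iff_map_eq_zero]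
  intro M hM
  ext k l
  refine hπ ?_
  rw [CStarMatrix.zero_apply, map_zero]
  ext v
  refine ext_inner_left ℂ fun u => ?_
  have h : inner ℂ ((u ⊗ₜ[ℂ] e k : K ⊗[ℂ] H) : HilbertTensor K H)
      (matrixTensorHom π e he M ((v ⊗ₜ[ℂ] e l : K ⊗[ℂ] H) : HilbertTensor K H)) = 0 := by
    simp [hM]
  have h1 (i j : n) : inner ℂ (e k) (if j = l then e i else 0) =
      if j = l then (if k = i then (1 : ℂ) else 0) else 0 := by
    split_ifs <;> simp [orthonormal_iff_ite.1 he, *, he.1]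
  simpa [matrixTensorHom_apply, inner_sum, inner_tensorOp_tmul, orthonormal_iff_ite.1 he, h1]
    using h

omit [CompleteSpace H] in
theorem orthonormal_coe_orthonormalBasis {n : Type*} [Fintype n] {F : Submodule ℂ H}
    (b : OrthonormalBasis n ℂ F) : Orthonormal ℂ fun k => (b k : H) :=
  b.orthonormal.comp_linearIsometry F.subtypeₗᵢ

omit [CompleteSpace H] in
theorem starProjection_conj_eq_sum {n : Type*} [Fintype n] (F : Submodule ℂ H)
    [F.HasOrthogonalProjection] (b : OrthonormalBasis n ℂ F) (a : H →L[ℂ] H) :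
    F.starProjection * a * F.starProjection =
      ∑ k, ∑ l, (inner ℂ (b k : H) (a (b l))) • rankOne ℂ (b k : H) (b l : H) := by
  rw [b.starProjection_eq_sum_rankOne]
  ext v
  simp [Finset.sum_mul, Finset.mul_sum, smul_smul]
  rw [Finset.sum_comm]
  simp [mul_comm]

theorem tensorOp_starProjection_conj_eq {ι n : Type*} [Fintype n] (π : A →⋆ₐ[ℂ] (K →L[ℂ] K))
    (F : Submodule ℂ H) [F.HasOrthogonalProjection] (b : OrthonormalBasis n ℂ F) (s : Finset ι)
    (x : ι → A) (a : ι → H →L[ℂ] H) :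
    tensorOp 1 F.starProjection * (∑ i ∈ s, tensorOp (π (x i)) (a i)) *
      tensorOp 1 F.starProjection =
      matrixTensorHom π (fun k => (b k : H)) (orthonormal_coe_orthonormalBasis b)
        (∑ i ∈ s, CStarMatrix.ofMatrix fun k l => (inner ℂ (b k : H) (a i (b l))) • x i) := by
  rw [map_sum, Finset.mul_sum, Finset.sum_mul]
  refine Finset.sum_congr rfl fun i _ => ?_
  rw [tensorOp_mul, tensorOp_mul, starProjection_conj_eq_sum F b, matrixTensorHom_apply]
  simp only [one_mul, mul_one, tensorOp_sum_right, tensorOp_smul_right]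
  refine Finset.sum_congr rfl fun k _ => Finset.sum_congr rfl fun l _ => ?_
  rw [← tensorOp_smul_left, ← map_smul]
  rfl

/-- Compression to a finite-dimensional `F` yields the image of a matrix over `A` that does not
depend on the representation. Injective *-homomorphisms of C*-algebras are isometric, so the
compressions under `π` and `π'` have equal norms, and compressing is contractive. -/
theorem norm_sum_tensorOp_conj_le {ι : Type*} {π : A →⋆ₐ[ℂ] (K →L[ℂ] K)}
    (hπ : Function.Injective π) {π' : A →⋆ₐ[ℂ] (K' →L[ℂ] K')} (hπ' : Function.Injective π')
    (s : Finset ι) (x : ι → A) (a : ι → H →L[ℂ] H) (F : Submodule ℂ H) [FiniteDimensional ℂ F] :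
    ‖tensorOp 1 F.starProjection * (∑ i ∈ s, tensorOp (π (x i)) (a i)) *
      tensorOp 1 F.starProjection‖ ≤ ‖∑ i ∈ s, tensorOp (π' (x i)) (a i)‖ := by
  let _ : PartialOrder A := CStarAlgebra.spectralOrder A
  have _ : StarOrderedRing A := CStarAlgebra.spectralOrderedRing A
  let b := stdOrthonormalBasis ℂ F
  have he := orthonormal_coe_orthonormalBasis b
  rw [tensorOp_starProjection_conj_eq π F b,
    NonUnitalStarAlgHom.norm_map (matrixTensorHom π _ he) (matrixTensorHom_injective hπ he),
    ← NonUnitalStarAlgHom.norm_map (matrixTensorHom π' _ he) (matrixTensorHom_injective hπ' he),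
    ← tensorOp_starProjection_conj_eq π' F b]
  have hP : ‖tensorOp (1 : K' →L[ℂ] K') F.starProjection‖ ≤ 1 :=
    (norm_tensorOp_le _ _).trans
      (mul_le_one₀ ContinuousLinearMap.norm_id_le (norm_nonneg _) F.starProjection_norm_le)
  refine (ContinuousLinearMap.opNorm_comp_le _ _).trans
    ((mul_le_of_le_one_right (norm_nonneg _) hP).trans ?_)
  exact (ContinuousLinearMap.opNorm_comp_le _ _).trans
    (mul_le_of_le_one_left (norm_nonneg _) hP)

omit [CompleteSpace H] [CompleteSpace K] in
-- An algebraic tensor involves only finitely many vectors of `H`. Allowing every larger `G` lets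
-- one subspace serve several tensors at once.
theorem exists_tensorOp_starProjection_eq (ξ : K ⊗[ℂ] H) :
    ∃ F : Submodule ℂ H, FiniteDimensional ℂ F ∧ ∀ G : Submodule ℂ H, F ≤ G →
      ∀ [G.HasOrthogonalProjection],
      tensorOp 1 G.starProjection (ξ : HilbertTensor K H) = (ξ : HilbertTensor K H) := by
  induction ξ using TensorProduct.induction_on with
  | zero => exact ⟨⊥, inferInstance, fun G _ _ => by
    rw [UniformSpace.Completion.coe_zero, map_zero]⟩
  | tmul k h =>
    refine ⟨ℂ ∙ h, inferInstance, fun G hG _ => ?_⟩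
    rw [tensorOp_coe_tmul, G.starProjection_eq_self_iff.2
      (hG (Submodule.mem_span_singleton_self h)), one_apply_eq_self]
  | add x y hx hy =>
    obtain ⟨F, hF, hx⟩ := hx
    obtain ⟨F', hF', hy⟩ := hy
    refine ⟨F ⊔ F', inferInstance, fun G hG _ => ?_⟩
    rw [UniformSpace.Completion.coe_add, map_add, hx G (le_sup_left.trans hG),
      hy G (le_sup_right.trans hG)]

/-- The minimal tensor norm does not depend on the faithful representation. -/
theorem norm_sum_tensorOp_le_of_injective {ι : Type*} {π : A →⋆ₐ[ℂ] (K →L[ℂ] K)}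
    (hπ : Function.Injective π) {π' : A →⋆ₐ[ℂ] (K' →L[ℂ] K')} (hπ' : Function.Injective π')
    (s : Finset ι) (x : ι → A) (a : ι → H →L[ℂ] H) :
    ‖∑ i ∈ s, tensorOp (π (x i)) (a i)‖ ≤ ‖∑ i ∈ s, tensorOp (π' (x i)) (a i)‖ := by
  set T := ∑ i ∈ s, tensorOp (π (x i)) (a i) with hT
  set C := ‖∑ i ∈ s, tensorOp (π' (x i)) (a i)‖ with hC
  -- By density ξ and η may be algebraic tensors, and then the coefficient sees only a
  -- finite-dimensional compression of `T`.
  have h (ξ η : HilbertTensor K H) : ‖inner ℂ ξ (T η)‖ ≤ C * ‖ξ‖ * ‖η‖ := by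
    induction ξ, η using UniformSpace.Completion.induction_on₂ with
    | hp => exact isClosed_le (by fun_prop) (by fun_prop)
    | ih ξ η =>
      obtain ⟨F, hF, hξ⟩ := exists_tensorOp_starProjection_eq ξ
      obtain ⟨F', hF', hη⟩ := exists_tensorOp_starProjection_eq η
      have hξ := hξ (F ⊔ F') le_sup_left
      have hη := hη (F ⊔ F') le_sup_right
      have hP : ContinuousLinearMap.adjoint (tensorOp (1 : K →L[ℂ] K) (F ⊔ F').starProjection) =
          tensorOp 1 (F ⊔ F').starProjection := by
        rw [← ContinuousLinearMap.star_eq_adjoint, star_tensorOp, star_one,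
          (isSelfAdjoint_starProjection (F ⊔ F')).star_eq]
      have : inner ℂ (ξ : HilbertTensor K H) (T η) = inner ℂ (ξ : HilbertTensor K H)
          ((tensorOp (1 : K →L[ℂ] K) (F ⊔ F').starProjection * T *
            tensorOp (1 : K →L[ℂ] K) (F ⊔ F').starProjection : HilbertTensor K H →L[ℂ]
              HilbertTensor K H) η) := by
        rw [mul_apply_eq_comp, mul_apply_eq_comp, hη,
          ← ContinuousLinearMap.adjoint_inner_left (tensorOp 1 _), hP, hξ]
      rw [this]
      calc _ ≤ ‖(ξ : HilbertTensor K H)‖ * _ := norm_inner_le_norm _ _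
        _ ≤ ‖(ξ : HilbertTensor K H)‖ * (C * ‖(η : HilbertTensor K H)‖) := by
          gcongr
          exact ContinuousLinearMap.le_of_opNorm_le _
            (norm_sum_tensorOp_conj_le hπ hπ' s x a (F ⊔ F')) _
        _ = _ := by ring
  refine ContinuousLinearMap.opNorm_le_of_re_inner_le (by rw [hC]; positivity) fun ξ η hξ hη => ?_
  have := h η ξ
  rw [hξ, hη, mul_one, mul_one, norm_inner_symm] at this
  exact (RCLike.re_le_norm _).trans this

end FaithfulRepresentations

/-! ### Alternating words in a free family. -/

section AlternatingWords

variable {I A : Type*} [CStarAlgebra A] [PartialOrder A] {φ : A →ₚ[ℂ] ℂ}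
  {𝒜 : I → StarSubalgebra ℂ A}

/-- A word in centred elements of the subalgebras `𝒜 i` whose neighbouring letters come from
different subalgebras. -/
def IsAlternatingWord (φ : A →ₚ[ℂ] ℂ) (𝒜 : I → StarSubalgebra ℂ A) (w : List (I × A)) : Prop :=
  (∀ p ∈ w, p.2 ∈ 𝒜 p.1 ∧ φ p.2 = 0) ∧ w.IsChain (fun p q => p.1 ≠ q.1)

/-- The span of the alternating words. -/
noncomputable def alternatingSpan (φ : A →ₚ[ℂ] ℂ) (𝒜 : I → StarSubalgebra ℂ A) : Submodule ℂ A :=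
  Submodule.span ℂ {a | ∃ w, IsAlternatingWord φ 𝒜 w ∧ (w.map Prod.snd).prod = a}

/-- The span of the alternating words whose first letter comes from `𝒜 i`. -/
noncomputable def headSpan (φ : A →ₚ[ℂ] ℂ) (𝒜 : I → StarSubalgebra ℂ A) (i : I) : Submodule ℂ A :=
  Submodule.span ℂ {a | ∃ p w, p.1 = i ∧ IsAlternatingWord φ 𝒜 (p :: w) ∧
    ((p :: w).map Prod.snd).prod = a}

/-- The span of the alternating words whose first letter, if any, does not come from `𝒜 i`. -/
noncomputable def offHeadSpan (φ : A →ₚ[ℂ] ℂ) (𝒜 : I → StarSubalgebra ℂ A) (i : I) : Submodule ℂ A :=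
  Submodule.span ℂ {a | ∃ w, (∀ p ∈ w.head?, p.1 ≠ i) ∧ IsAlternatingWord φ 𝒜 w ∧
    (w.map Prod.snd).prod = a}

theorem headSpan_le_alternatingSpan (i : I) : headSpan φ 𝒜 i ≤ alternatingSpan φ 𝒜 :=
  Submodule.span_mono fun _ ⟨p, w, _, hw, ha⟩ => ⟨p :: w, hw, ha⟩

theorem offHeadSpan_le_alternatingSpan (i : I) : offHeadSpan φ 𝒜 i ≤ alternatingSpan φ 𝒜 :=
  Submodule.span_mono fun _ ⟨w, _, hw, ha⟩ => ⟨w, hw, ha⟩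

theorem headSpan_le_offHeadSpan {i j : I} (hij : i ≠ j) : headSpan φ 𝒜 i ≤ offHeadSpan φ 𝒜 j :=
  Submodule.span_mono fun _ ⟨p, w, hp, hw, ha⟩ => ⟨p :: w, by simpa [hp] using hij, hw, ha⟩

theorem alternatingSpan_le_sup (i : I) :
    alternatingSpan φ 𝒜 ≤ headSpan φ 𝒜 i ⊔ offHeadSpan φ 𝒜 i := by
  refine Submodule.span_le.2 ?_
  rintro _ ⟨w, hw, rfl⟩
  rcases w with _ | ⟨p, w⟩
  · exact Submodule.mem_sup_right (Submodule.subset_span ⟨[], by simp, hw, rfl⟩)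
  · by_cases hp : p.1 = i
    · exact Submodule.mem_sup_left (Submodule.subset_span ⟨p, w, hp, hw, rfl⟩)
    · exact Submodule.mem_sup_right (Submodule.subset_span ⟨p :: w, by simpa using hp, hw, rfl⟩)

theorem one_mem_offHeadSpan (i : I) : (1 : A) ∈ offHeadSpan φ 𝒜 i :=
  Submodule.subset_span ⟨[], by simp, ⟨by simp, by simp⟩, by simp⟩

theorem one_mem_alternatingSpan : (1 : A) ∈ alternatingSpan φ 𝒜 :=
  Submodule.subset_span ⟨[], ⟨by simp, by simp⟩, by simp⟩

theorem IsAlternatingWord.cons {i : I} {b : A} {w : List (I × A)} (hb : b ∈ 𝒜 i) (hb0 : φ b = 0)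
    (hw : IsAlternatingWord φ 𝒜 w) (hi : ∀ p ∈ w.head?, p.1 ≠ i) :
    IsAlternatingWord φ 𝒜 ((i, b) :: w) := by
  refine ⟨?_, List.isChain_cons.2 ⟨fun p hp => (hi p hp).symm, hw.2⟩⟩
  rintro p (_ | ⟨_, hp⟩)
  exacts [⟨hb, hb0⟩, hw.1 p hp]

theorem mul_mem_headSpan {i : I} {b a : A} (hb : b ∈ 𝒜 i) (hb0 : φ b = 0)
    (ha : a ∈ offHeadSpan φ 𝒜 i) : b * a ∈ headSpan φ 𝒜 i := by
  refine (Submodule.span_le (p := (headSpan φ 𝒜 i).comap (LinearMap.mulLeft ℂ b))).2 ?_ ha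
  rintro _ ⟨w, hi, hw, rfl⟩
  exact Submodule.subset_span ⟨(i, b), w, rfl, hw.cons hb hb0 hi, by simp⟩

theorem sub_smul_one_mem {i : I} {b : A} (hb : b ∈ 𝒜 i) : b - φ b • 1 ∈ 𝒜 i :=
  sub_mem hb (SMulMemClass.smul_mem _ (one_mem _))

theorem map_sub_smul_one (hφ : φ 1 = 1) (b : A) : φ (b - φ b • 1) = 0 := by
  simp [hφ]

/-- Split off the mean of the left factor: its centred part prolongs a word not starting in `𝒜 i`,
and its scalar part leaves the word unchanged. If the word does start in `𝒜 i`, first merge `b` with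
its first letter; the remaining word no longer starts there. -/
theorem mul_mem_alternatingSpan (hφ : φ 1 = 1) {i : I} {b a : A} (hb : b ∈ 𝒜 i)
    (ha : a ∈ alternatingSpan φ 𝒜) : b * a ∈ alternatingSpan φ 𝒜 := by
  have off {c d : A} (hc : c ∈ 𝒜 i) (hd : d ∈ offHeadSpan φ 𝒜 i) :
      c * d ∈ alternatingSpan φ 𝒜 := by
    have : c * d = (c - φ c • 1) * d + φ c • d := by simp [sub_mul]
    rw [this]
    exact add_mem (headSpan_le_alternatingSpan i
      (mul_mem_headSpan (sub_smul_one_mem hc) (map_sub_smul_one hφ c) hd))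
      (Submodule.smul_mem _ _ (offHeadSpan_le_alternatingSpan i hd))
  obtain ⟨v, hv, n, hn, rfl⟩ := Submodule.mem_sup.1 (alternatingSpan_le_sup i ha)
  rw [mul_add]
  refine add_mem ?_ (off hb hn)
  refine (Submodule.span_le
    (p := (alternatingSpan φ 𝒜).comap (LinearMap.mulLeft ℂ b))).2 ?_ hv
  rintro _ ⟨p, w, rfl, hw, rfl⟩
  have hp := hw.1 p (by simp)
  have hw' := List.isChain_cons.1 hw.2
  have : b * ((p :: w).map Prod.snd).prod = (b * p.2) * (w.map Prod.snd).prod := by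
    simp [mul_assoc]
  change b * ((p :: w).map Prod.snd).prod ∈ alternatingSpan φ 𝒜
  rw [this]
  exact off (mul_mem hb hp.1) (Submodule.subset_span
    ⟨w, fun q hq => (hw'.1 q hq).symm, ⟨fun q hq => hw.1 q (by simp [hq]), hw'.2⟩, rfl⟩)

theorem adjoin_le_alternatingSpan (hφ : φ 1 = 1) {a : A}
    (ha : a ∈ StarAlgebra.adjoin ℂ (⋃ i, (𝒜 i : Set A))) : a ∈ alternatingSpan φ 𝒜 := by
  -- Invariance under left multiplication by both `a` and `star a` is stable under products and
  -- adjoints; evaluation at `d = 1` gives the claim.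
  suffices h : ∀ d ∈ alternatingSpan φ 𝒜,
      a * d ∈ alternatingSpan φ 𝒜 ∧ star a * d ∈ alternatingSpan φ 𝒜 by
    simpa using (h 1 one_mem_alternatingSpan).1
  induction ha using StarAlgebra.adjoin_induction with
  | mem x hx =>
    obtain ⟨i, hi⟩ := Set.mem_iUnion.1 hx
    exact fun d hd => ⟨mul_mem_alternatingSpan hφ hi hd,
      mul_mem_alternatingSpan hφ (star_mem (s := 𝒜 i) hi) hd⟩
  | algebraMap r =>
    intro d hd
    simp only [Algebra.algebraMap_eq_smul_one, star_smul, star_one, smul_mul_assoc, one_mul]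
    exact ⟨Submodule.smul_mem _ _ hd, Submodule.smul_mem _ _ hd⟩
  | add x y _ _ hx hy =>
    intro d hd
    simp only [star_add, add_mul]
    exact ⟨add_mem (hx d hd).1 (hy d hd).1, add_mem (hx d hd).2 (hy d hd).2⟩
  | mul x y _ _ hx hy =>
    intro d hd
    simp only [star_mul, mul_assoc]
    exact ⟨(hx _ (hy d hd).1).1, (hy _ (hx d hd).2).2⟩
  | star x _ hx =>
    intro d hd
    rw [star_star]
    exact (hx d hd).symm

omit [PartialOrder A] in
theorem star_prod_map_snd (w : List (I × A)) : star (w.map Prod.snd).prod =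
    ((w.reverse.map fun p => (p.1, star p.2)).map Prod.snd).prod := by
  induction w with
  | nil => simp
  | cons p w ih => simp_all

theorem mem_headSpan {i : I} {b : A} (hb : b ∈ 𝒜 i) (hb0 : φ b = 0) : b ∈ headSpan φ 𝒜 i := by
  simpa using mul_mem_headSpan hb hb0 (one_mem_offHeadSpan i)

variable [StarOrderedRing A]

theorem IsAlternatingWord.reverse_star {w : List (I × A)} (hw : IsAlternatingWord φ 𝒜 w) :
    IsAlternatingWord φ 𝒜 (w.reverse.map fun p => (p.1, star p.2)) := by
  refine ⟨?_, ?_⟩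
  · intro p hp
    obtain ⟨q, hq, rfl⟩ := List.mem_map.1 hp
    have := hw.1 q (List.mem_reverse.1 hq)
    exact ⟨star_mem (s := 𝒜 q.1) this.1, by simp [map_star, this.2]⟩
  · rw [List.isChain_map, List.isChain_reverse]
    exact hw.2.imp fun _ _ h => h.symm

/-- The adjoint of a word starting in `𝒜 i` ends in `𝒜 i`. Followed by a word that is empty or
starts elsewhere, it is again a nonempty alternating word, on which `φ` vanishes by freeness. -/
theorem map_star_mul_eq_zero (hfree : IsFreeFamily φ 𝒜) {i : I} {v n : A}
    (hv : v ∈ headSpan φ 𝒜 i) (hn : n ∈ offHeadSpan φ 𝒜 i) : φ (star v * n) = 0 := by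
  induction hv using Submodule.span_induction with
  | zero => simp
  | add x y _ _ hx hy => simp [add_mul, hx, hy]
  | smul c x _ hx => simp [hx]
  | mem v hv =>
    obtain ⟨p, w, hp, hw, rfl⟩ := hv
    induction hn using Submodule.span_induction with
    | zero => simp
    | add x y _ _ hx hy => rw [mul_add, map_add, hx, hy, add_zero]
    | smul c x _ hx => rw [mul_smul_comm, map_smul, hx, smul_zero]
    | mem n hn =>
      obtain ⟨u, hi, hu, rfl⟩ := hn
      rw [star_prod_map_snd, ← List.prod_append, ← List.map_append]
      refine hfree _ (by simp) (fun q hq => ?_) ?_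
      · rcases List.mem_append.1 hq with hq | hq
        exacts [hw.reverse_star.1 q hq, hu.1 q hq]
      · refine List.isChain_append.2 ⟨hw.reverse_star.2, hu.2, fun q hq r hr => ?_⟩
        have hq : q = (p.1, star p.2) := by simpa using hq.symm
        rw [hq, hp]
        exact (hi r hr).symm

end AlternatingWords

/-! ### Row and column estimates for sums of tensors. -/

section OperatorInequalities

/-- Each term is `p y* y p ≤ p`, and a sum of mutually orthogonal projections is a projection. -/
theorem norm_sum_star_mul_proj_le_one {ι B : Type*} [CStarAlgebra B] (s : Finset ι) {p y : ι → B}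
    (hp : ∀ i, IsStarProjection (p i)) (horth : ∀ i j, i ≠ j → p i * p j = 0)
    (hy : ∀ i, ‖y i‖ ≤ 1) : ‖∑ i ∈ s, star (y i * p i) * (y i * p i)‖ ≤ 1 := by
  classical
  let _ : PartialOrder B := CStarAlgebra.spectralOrder B
  have _ : StarOrderedRing B := CStarAlgebra.spectralOrderedRing B
  have hle : ∑ i ∈ s, star (y i * p i) * (y i * p i) ≤ ∑ i ∈ s, p i := by
    refine Finset.sum_le_sum fun i _ => ?_
    have h1 : star (y i) * y i ≤ 1 := by
      rw [← CStarAlgebra.norm_le_one_iff_of_nonneg _ (star_mul_self_nonneg _),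
        CStarRing.norm_star_mul_self]
      exact mul_le_one₀ (hy i) (norm_nonneg _) (hy i)
    have h2 := star_left_conjugate_le_conjugate h1 (p i)
    rw [mul_one, (hp i).isSelfAdjoint.star_eq, (hp i).isIdempotentElem.eq] at h2
    rwa [star_mul, (hp i).isSelfAdjoint.star_eq, mul_assoc, ← mul_assoc (star (y i)),
      ← mul_assoc (p i)]
  have hP : IsStarProjection (∑ i ∈ s, p i) := by
    refine ⟨?_, ?_⟩
    · rw [IsIdempotentElem, Finset.sum_mul_sum]
      refine Finset.sum_congr rfl fun i hi => ?_
      rw [Finset.sum_eq_single_of_mem i hi fun j _ hj => horth i j hj.symm,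
        (hp i).isIdempotentElem.eq]
    · rw [IsSelfAdjoint, star_sum]
      exact Finset.sum_congr rfl fun i _ => (hp i).isSelfAdjoint.star_eq
  exact (CStarAlgebra.norm_le_norm_of_nonneg_of_le
    (Finset.sum_nonneg fun i _ => star_mul_self_nonneg _) hle).trans (hP.norm_le _)

variable {ι K H : Type*} [NormedAddCommGroup H] [InnerProductSpace ℂ H] [CompleteSpace H]
  [NormedAddCommGroup K] [InnerProductSpace ℂ K] [CompleteSpace K]

omit [CompleteSpace H] [CompleteSpace K] in
theorem norm_tensorOp_one_left_le (T : H →L[ℂ] H) : ‖tensorOp (1 : K →L[ℂ] K) T‖ ≤ ‖T‖ :=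
  (norm_tensorOp_le _ _).trans
    (mul_le_of_le_one_left (norm_nonneg _) ContinuousLinearMap.norm_id_le)

omit [CompleteSpace H] [CompleteSpace K] in
theorem norm_tensorOp_one_right_le (S : K →L[ℂ] K) : ‖tensorOp S (1 : H →L[ℂ] H)‖ ≤ ‖S‖ :=
  (norm_tensorOp_le _ _).trans
    (mul_le_of_le_one_right (norm_nonneg _) ContinuousLinearMap.norm_id_le)

/-- Cauchy–Schwarz applied to the factorization `S i ⊗ a i = (1 ⊗ a i) (S i ⊗ 1)`. -/
theorem norm_sum_tensorOp_le_row (s : Finset ι) {S : ι → K →L[ℂ] K} (a : ι → H →L[ℂ] H)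
    (hS : ‖∑ i ∈ s, star (S i) * S i‖ ≤ 1) :
    ‖∑ i ∈ s, tensorOp (S i) (a i)‖ ≤ √‖∑ i ∈ s, a i * star (a i)‖ := by
  have h := norm_sum_star_mul_le s (fun i => star (tensorOp (1 : K →L[ℂ] K) (a i)))
    (fun i => tensorOp (S i) (1 : H →L[ℂ] H))
  simp only [star_star, star_tensorOp, tensorOp_mul, star_one, one_mul, mul_one,
    ← tensorOp_sum_left, ← tensorOp_sum_right] at h
  refine h.trans ((mul_le_of_le_one_right (Real.sqrt_nonneg _) (Real.sqrt_le_one.2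
    ((norm_tensorOp_one_right_le _).trans hS))).trans ?_)
  exact Real.sqrt_le_sqrt (norm_tensorOp_one_left_le _)

theorem norm_sum_tensorOp_star (s : Finset ι) (S : ι → K →L[ℂ] K) (a : ι → H →L[ℂ] H) :
    ‖∑ i ∈ s, tensorOp (star (S i)) (star (a i))‖ = ‖∑ i ∈ s, tensorOp (S i) (a i)‖ := by
  simp only [← star_tensorOp]
  rw [← star_sum (R := HilbertTensor K H →L[ℂ] HilbertTensor K H)]
  exact LinearIsometryEquiv.norm_map ContinuousLinearMap.adjoint _

theorem norm_sum_tensorOp_le_column (s : Finset ι) {S : ι → K →L[ℂ] K} (a : ι → H →L[ℂ] H)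
    (hS : ‖∑ i ∈ s, S i * star (S i)‖ ≤ 1) :
    ‖∑ i ∈ s, tensorOp (S i) (a i)‖ ≤ √‖∑ i ∈ s, star (a i) * a i‖ := by
  have h := norm_sum_tensorOp_le_row s (S := fun i => star (S i)) (fun i => star (a i))
    (by simpa using hS)
  simp only [star_star] at h
  rwa [norm_sum_tensorOp_star] at h

/-- Split `x = x P + P x (1 - P)`. The first summand has `P` on the right and obeys the row
estimate; the second has `P` on the left, so its adjoint has `P` on the right and the column
estimate applies. -/
theorem norm_sum_tensorOp_le_row_add_column (s : Finset ι) {x P : ι → K →L[ℂ] K}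
    (hx : ∀ i, ‖x i‖ ≤ 1) (hP : ∀ i, IsStarProjection (P i))
    (horth : ∀ i j, i ≠ j → P i * P j = 0) (hxP : ∀ i, P i * (x i * (1 - P i)) = x i * (1 - P i))
    (a : ι → H →L[ℂ] H) :
    ‖∑ i ∈ s, tensorOp (x i) (a i)‖ ≤
      √‖∑ i ∈ s, a i * star (a i)‖ + √‖∑ i ∈ s, star (a i) * a i‖ := by
  have hsplit : ∑ i ∈ s, tensorOp (x i) (a i) = ∑ i ∈ s, tensorOp (x i * P i) (a i) +
      ∑ i ∈ s, tensorOp (P i * (x i * (1 - P i))) (a i) := by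
    rw [← Finset.sum_add_distrib]
    refine Finset.sum_congr rfl fun i _ => ?_
    rw [hxP, ← tensorOp_add_left, ← mul_add, add_sub_cancel, mul_one]
  rw [hsplit]
  refine (ContinuousLinearMap.opNorm_add_le _ _).trans (add_le_add (norm_sum_tensorOp_le_row s a ?_)
    (norm_sum_tensorOp_le_column s a ?_))
  · exact norm_sum_star_mul_proj_le_one s hP horth hx
  · have h := norm_sum_star_mul_proj_le_one s (y := fun i => star (x i * (1 - P i))) hP horth
      fun i => by
        rw [norm_star]
        exact (norm_mul_le _ _).trans (mul_le_one₀ (hx i) (norm_nonneg _) ((hP i).one_sub.norm_le _))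
    simpa only [star_mul (star (x _ * (1 - P _))) (P _), star_star, (hP _).isSelfAdjoint.star_eq,
      star_mul (P _) (x _ * (1 - P _))] using h

/-- The left side of `h` is the quadratic form of `∑ star (a i) * a i` at `v`, so `h` is the
operator inequality `∑ star (a i) * a i ≤ r`. -/
theorem norm_sum_star_mul_le_of_sum_sq_le (s : Finset ι) (a : ι → H →L[ℂ] H) {r : ℝ} (hr : 0 ≤ r)
    (h : ∀ v, ∑ i ∈ s, ‖a i v‖ ^ 2 ≤ r * ‖v‖ ^ 2) : ‖∑ i ∈ s, star (a i) * a i‖ ≤ r := by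
  have h0 : 0 ≤ ∑ i ∈ s, star (a i) * a i := Finset.sum_nonneg fun i _ => star_mul_self_nonneg _
  rw [CStarAlgebra.norm_le_iff_le_algebraMap _ hr h0, ContinuousLinearMap.le_def,
    ContinuousLinearMap.isPositive_def']
  refine ⟨IsSelfAdjoint.sub (.algebraMap _ (.all r)) (.of_nonneg h0), fun v => ?_⟩
  rw [ContinuousLinearMap.reApplyInnerSelf_apply]
  have h1 (i : ι) : inner ℂ ((star (a i) * a i) v) v = ((‖a i v‖ ^ 2 : ℝ) : ℂ) := by
    rw [mul_apply_eq_comp, ContinuousLinearMap.star_eq_adjoint,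
      ContinuousLinearMap.adjoint_inner_left, inner_self_eq_norm_sq_to_K]
    simp
  have h2 : inner ℂ ((algebraMap ℝ (H →L[ℂ] H) r) v) v = ((r * ‖v‖ ^ 2 : ℝ) : ℂ) := by
    rw [Algebra.algebraMap_eq_smul_one]
    simp [inner_smul_left_eq_smul, inner_self_eq_norm_sq_to_K]
  rw [sub_apply, inner_sub_left, h2, sum_apply, sum_inner]
  simp only [h1]
  rw [← Complex.ofReal_sum, ← Complex.ofReal_sub]
  exact sub_nonneg.2 (h v)

omit [CompleteSpace K] in
-- Evaluate on `Ω ⊗ v`: the vectors `x i Ω ⊗ a i v` are mutually orthogonal, so Pythagoras computes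
-- the norm of their sum.
theorem mul_sqrt_norm_sum_star_mul_le (s : Finset ι) {x : ι → K →L[ℂ] K} (a : ι → H →L[ℂ] H)
    {Ω : K} (hΩ : ‖Ω‖ = 1) {δ : ℝ} (hδ : 0 < δ)
    (horth : ∀ i j, i ≠ j → inner ℂ (x i Ω) (x j Ω) = 0) (hx : ∀ i, δ ^ 2 ≤ ‖x i Ω‖ ^ 2) :
    δ * √‖∑ i ∈ s, star (a i) * a i‖ ≤ ‖∑ i ∈ s, tensorOp (x i) (a i)‖ := by
  set T := ∑ i ∈ s, tensorOp (x i) (a i) with hT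
  have hnorm (v : H) : ‖T ((Ω ⊗ₜ[ℂ] v : K ⊗[ℂ] H) : HilbertTensor K H)‖ ^ 2 =
      ∑ i ∈ s, ‖x i Ω‖ ^ 2 * ‖a i v‖ ^ 2 := by
    rw [← Complex.ofReal_inj]
    rw [Complex.ofReal_pow]
    have := inner_self_eq_norm_sq_to_K (𝕜 := ℂ) (T ((Ω ⊗ₜ[ℂ] v : K ⊗[ℂ] H) : HilbertTensor K H))
    refine this.symm.trans ?_
    rw [hT, sum_apply, sum_inner, Complex.ofReal_sum]
    refine Finset.sum_congr rfl fun i hi => ?_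
    rw [inner_sum, Finset.sum_eq_single_of_mem i hi]
    · rw [tensorOp_coe_tmul, UniformSpace.Completion.inner_coe, TensorProduct.inner_tmul,
        inner_self_eq_norm_sq_to_K, inner_self_eq_norm_sq_to_K]
      simp
    · intro j _ hj
      rw [tensorOp_coe_tmul, tensorOp_coe_tmul, UniformSpace.Completion.inner_coe,
        TensorProduct.inner_tmul, horth i j hj.symm, zero_mul]
  have hsum (v : H) : ∑ i ∈ s, ‖a i v‖ ^ 2 ≤ (‖T‖ / δ) ^ 2 * ‖v‖ ^ 2 := by
    rw [div_pow, div_mul_eq_mul_div, le_div_iff₀ (by positivity), mul_comm, Finset.mul_sum]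
    calc ∑ i ∈ s, δ ^ 2 * ‖a i v‖ ^ 2 ≤ ∑ i ∈ s, ‖x i Ω‖ ^ 2 * ‖a i v‖ ^ 2 :=
          Finset.sum_le_sum fun i _ => mul_le_mul_of_nonneg_right (hx i) (sq_nonneg _)
      _ = ‖T ((Ω ⊗ₜ[ℂ] v : K ⊗[ℂ] H) : HilbertTensor K H)‖ ^ 2 := (hnorm v).symm
      _ ≤ (‖T‖ * ‖((Ω ⊗ₜ[ℂ] v : K ⊗[ℂ] H) : HilbertTensor K H)‖) ^ 2 := by
          gcongr; exact T.le_opNorm _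
      _ = ‖T‖ ^ 2 * ‖v‖ ^ 2 := by
          rw [UniformSpace.Completion.norm_coe, TensorProduct.norm_tmul, hΩ, one_mul, mul_pow]
  have h := norm_sum_star_mul_le_of_sum_sq_le s a (by positivity) hsum
  rw [mul_comm, ← le_div_iff₀ hδ]
  exact Real.sqrt_le_iff.2 ⟨by positivity, h⟩

end OperatorInequalities

/-! ### The GNS space and its projections onto words with prescribed first letter. -/

section GNS

variable {A : Type*} [CStarAlgebra A] [PartialOrder A] [StarOrderedRing A] (φ : A →ₚ[ℂ] ℂ)

/-- The canonical map `a ↦ a Ω` of `A` into the GNS space of `φ`. -/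
noncomputable def gnsVector : A →ₗ[ℂ] φ.GNS where
  toFun a := (φ.toPreGNS a : φ.GNS)
  map_add' a b := by rw [map_add, UniformSpace.Completion.coe_add]
  map_smul' c a := by rw [map_smul, UniformSpace.Completion.coe_smul, RingHom.id_apply]

theorem inner_gnsVector (a b : A) :
    inner ℂ (gnsVector φ a) (gnsVector φ b) = φ (star a * b) := by
  change inner ℂ (φ.toPreGNS a : φ.GNS) (φ.toPreGNS b : φ.GNS) = _
  rw [UniformSpace.Completion.inner_coe, PositiveLinearMap.preGNS_inner_def]
  simp

theorem norm_gnsVector_sq (a : A) : ‖gnsVector φ a‖ ^ 2 = (φ (star a * a)).re := by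
  rw [← inner_gnsVector, ← inner_self_eq_norm_sq (𝕜 := ℂ)]
  rfl

theorem gnsStarAlgHom_gnsVector (a b : A) :
    φ.gnsStarAlgHom a (gnsVector φ b) = gnsVector φ (a * b) := by
  change φ.gnsNonUnitalStarAlgHom a (φ.toPreGNS b : φ.GNS) = (φ.toPreGNS (a * b) : φ.GNS)
  rw [PositiveLinearMap.gnsNonUnitalStarAlgHom_apply_coe, PositiveLinearMap.leftMulMapPreGNS_apply]
  simp

theorem denseRange_gnsVector : DenseRange (gnsVector φ) :=
  UniformSpace.Completion.denseRange_coe.comp φ.toPreGNS.surjective.denseRange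
    (UniformSpace.Completion.continuous_coe _)

theorem norm_gnsStarAlgHom_le (a : A) : ‖φ.gnsStarAlgHom a‖ ≤ ‖a‖ :=
  NonUnitalStarAlgHom.norm_apply_le φ.gnsStarAlgHom a

theorem norm_gnsVector_le (a : A) : ‖gnsVector φ a‖ ≤ ‖gnsVector φ 1‖ * ‖a‖ := by
  conv_lhs => rw [← mul_one a, ← gnsStarAlgHom_gnsVector]
  exact (ContinuousLinearMap.le_of_opNorm_le _ (norm_gnsStarAlgHom_le φ a) _).trans
    (mul_comm _ _).le

theorem continuous_gnsVector : Continuous (gnsVector φ) :=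
  AddMonoidHomClass.continuous_of_bound (gnsVector φ) _ (norm_gnsVector_le φ)

variable {φ}

/-- Faithfulness of the state makes the cyclic vector separating. -/
theorem gnsStarAlgHom_injective (hφ : IsFaithfulState φ) :
    Function.Injective φ.gnsStarAlgHom := by
  rw [injective_iff_map_eq_zero]
  intro a ha
  refine hφ.faithful a ?_
  have h : gnsVector φ a = 0 := by
    rw [← mul_one a, ← gnsStarAlgHom_gnsVector, ha, zero_apply]
  rw [← inner_gnsVector, h, inner_zero_left]

variable {I : Type*} {𝒜 : I → StarSubalgebra ℂ A}

/-- The closed span in the GNS space of the alternating words with first letter in `𝒜 i`. -/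
noncomputable def gnsHeadSpace (φ : A →ₚ[ℂ] ℂ) (𝒜 : I → StarSubalgebra ℂ A) (i : I) :
    Submodule ℂ φ.GNS :=
  ((headSpan φ 𝒜 i).map (gnsVector φ)).topologicalClosure

noncomputable instance (i : I) : CompleteSpace (gnsHeadSpace φ 𝒜 i) :=
  ((headSpan φ 𝒜 i).map (gnsVector φ)).isClosed_topologicalClosure.completeSpace_coe

theorem gnsVector_mem_gnsHeadSpace {i : I} {v : A} (hv : v ∈ headSpan φ 𝒜 i) :
    gnsVector φ v ∈ gnsHeadSpace φ 𝒜 i :=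
  Submodule.le_topologicalClosure _ (Submodule.mem_map_of_mem hv)

theorem gnsVector_mem_gnsHeadSpace_orthogonal (hfree : IsFreeFamily φ 𝒜) {i : I} {n : A}
    (hn : n ∈ offHeadSpan φ 𝒜 i) : gnsVector φ n ∈ (gnsHeadSpace φ 𝒜 i)ᗮ := by
  rw [gnsHeadSpace, Submodule.orthogonal_closure, Submodule.mem_orthogonal]
  rintro _ ⟨v, hv, rfl⟩
  rw [inner_gnsVector]
  exact map_star_mul_eq_zero hfree hv hn

theorem gnsHeadSpace_isOrtho (hfree : IsFreeFamily φ 𝒜) {i j : I} (hij : i ≠ j) :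
    gnsHeadSpace φ 𝒜 i ⟂ gnsHeadSpace φ 𝒜 j := by
  rw [Submodule.isOrtho_iff_le]
  refine Submodule.topologicalClosure_minimal _ ?_ (Submodule.isClosed_orthogonal _)
  rintro _ ⟨v, hv, rfl⟩
  exact gnsVector_mem_gnsHeadSpace_orthogonal hfree (headSpan_le_offHeadSpan hij hv)

/-- On a combination of words, `1 - P` keeps exactly the part not starting in `𝒜 i`; left
multiplication by the centred `x` turns that part into words starting in `𝒜 i`, which `P` fixes.
Such combinations are dense because the `𝒜 i` generate `A`. -/
theorem gnsStarAlgHom_mul_one_sub_starProjection (hφ : φ 1 = 1) (hfree : IsFreeFamily φ 𝒜)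
    (hdense : Dense (StarAlgebra.adjoin ℂ (⋃ i, (𝒜 i : Set A)) : Set A))
    {i : I} {x : A} (hx : x ∈ 𝒜 i) (hx0 : φ x = 0) :
    (gnsHeadSpace φ 𝒜 i).starProjection *
      (φ.gnsStarAlgHom x * (1 - (gnsHeadSpace φ 𝒜 i).starProjection)) =
      φ.gnsStarAlgHom x * (1 - (gnsHeadSpace φ 𝒜 i).starProjection) := by
  set P := (gnsHeadSpace φ 𝒜 i).starProjection
  have hD : Dense (gnsVector φ '' (alternatingSpan φ 𝒜 : Set A)) :=
    (denseRange_gnsVector φ).dense_image (continuous_gnsVector φ)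
      (hdense.mono fun _ ha => adjoin_le_alternatingSpan hφ ha)
  refine DFunLike.coe_injective (Continuous.ext_on hD (ContinuousLinearMap.continuous _)
    (ContinuousLinearMap.continuous _) ?_)
  rintro _ ⟨d, hd, rfl⟩
  obtain ⟨v, hv, n, hn, rfl⟩ := Submodule.mem_sup.1 (alternatingSpan_le_sup i hd)
  have h1 : (1 - P) (gnsVector φ (v + n)) = gnsVector φ n := by
    rw [sub_apply, one_apply_eq_self, map_add, map_add,
      Submodule.starProjection_eq_self_iff.2 (gnsVector_mem_gnsHeadSpace hv),
      (Submodule.starProjection_apply_eq_zero_iff _).2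
        (gnsVector_mem_gnsHeadSpace_orthogonal hfree hn)]
    abel
  simp only [mul_apply_eq_comp]
  rw [h1, gnsStarAlgHom_gnsVector]
  exact Submodule.starProjection_eq_self_iff.2
    (gnsVector_mem_gnsHeadSpace (mul_mem_headSpan hx hx0 hn))

end GNS

/-! ### The inequalities when the subalgebras generate `A`. -/

section Khintchine

variable {I A H : Type*} [CStarAlgebra A] [PartialOrder A] [StarOrderedRing A]
  [NormedAddCommGroup H] [InnerProductSpace ℂ H] [CompleteSpace H]
  {φ : A →ₚ[ℂ] ℂ} {𝒜 : I → StarSubalgebra ℂ A}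

theorem norm_sum_tensorOp_gns_le (hφ : φ 1 = 1) (hfree : IsFreeFamily φ 𝒜)
    (hdense : Dense (StarAlgebra.adjoin ℂ (⋃ i, (𝒜 i : Set A)) : Set A))
    {x : I → A} (hx : ∀ i, x i ∈ 𝒜 i) (hx1 : ∀ i, ‖x i‖ ≤ 1) (hx0 : ∀ i, φ (x i) = 0)
    (s : Finset I) (a : I → H →L[ℂ] H) :
    ‖∑ i ∈ s, tensorOp (φ.gnsStarAlgHom (x i)) (a i)‖ ≤
      √‖∑ i ∈ s, a i * star (a i)‖ + √‖∑ i ∈ s, star (a i) * a i‖ :=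
  norm_sum_tensorOp_le_row_add_column s (P := fun i => (gnsHeadSpace φ 𝒜 i).starProjection)
    (fun i => (norm_gnsStarAlgHom_le φ _).trans (hx1 i))
    (fun _ => isStarProjection_starProjection)
    (fun _ _ hij => (gnsHeadSpace_isOrtho hfree hij).starProjection_comp_starProjection)
    (fun i => gnsStarAlgHom_mul_one_sub_starProjection hφ hfree hdense (hx i) (hx0 i)) a

theorem mul_sqrt_norm_sum_star_mul_le_gns (hφ : φ 1 = 1) (hfree : IsFreeFamily φ 𝒜)
    {x : I → A} (hx : ∀ i, x i ∈ 𝒜 i) (hx0 : ∀ i, φ (x i) = 0)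
    {δ : ℝ} (hδ : 0 < δ) (hxδ : ∀ i, δ ^ 2 ≤ (φ (star (x i) * x i)).re)
    (s : Finset I) (a : I → H →L[ℂ] H) :
    δ * √‖∑ i ∈ s, star (a i) * a i‖ ≤
      ‖∑ i ∈ s, tensorOp (φ.gnsStarAlgHom (x i)) (a i)‖ := by
  have h1 (i : I) : φ.gnsStarAlgHom (x i) (gnsVector φ 1) = gnsVector φ (x i) := by
    rw [gnsStarAlgHom_gnsVector, mul_one]
  refine mul_sqrt_norm_sum_star_mul_le s a (Ω := gnsVector φ 1) ?_ hδ (fun i j hij => ?_)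
    fun i => ?_
  · rw [← sq_eq_sq₀ (norm_nonneg _) zero_le_one, norm_gnsVector_sq]
    simp [hφ]
  · rw [h1, h1, inner_gnsVector]
    exact map_star_mul_eq_zero hfree (mem_headSpan (hx i) (hx0 i))
      (headSpan_le_offHeadSpan hij.symm (mem_headSpan (hx j) (hx0 j)))
  · rw [h1, norm_gnsVector_sq]
    exact hxδ i

theorem khintchine_of_dense (hφ : IsFaithfulState φ) (hfree : IsFreeFamily φ 𝒜)
    (hdense : Dense (StarAlgebra.adjoin ℂ (⋃ i, (𝒜 i : Set A)) : Set A))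
    {δ : ℝ} (hδ : 0 < δ)
    {x : I → A} (hx : ∀ i, x i ∈ 𝒜 i) (hx1 : ∀ i, ‖x i‖ ≤ 1) (hx0 : ∀ i, φ (x i) = 0)
    (hxδ : ∀ i, δ ^ 2 ≤ min (φ (star (x i) * x i)).re (φ (x i * star (x i))).re)
    {K : Type*} [NormedAddCommGroup K] [InnerProductSpace ℂ K] [CompleteSpace K]
    {π : A →⋆ₐ[ℂ] (K →L[ℂ] K)} (hπ : Function.Injective π)
    (s : Finset I) (a : I → H →L[ℂ] H) :
    δ * max √‖∑ i ∈ s, star (a i) * a i‖ √‖∑ i ∈ s, a i * star (a i)‖ ≤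
        ‖∑ i ∈ s, tensorOp (π (x i)) (a i)‖ ∧
      ‖∑ i ∈ s, tensorOp (π (x i)) (a i)‖ ≤
        2 * max √‖∑ i ∈ s, star (a i) * a i‖ √‖∑ i ∈ s, a i * star (a i)‖ := by
  have hinj := gnsStarAlgHom_injective hφ
  rw [le_antisymm (norm_sum_tensorOp_le_of_injective hπ hinj s x a)
    (norm_sum_tensorOp_le_of_injective hinj hπ s x a)]
  refine ⟨?_, ?_⟩
  · rw [mul_max_of_nonneg _ _ hδ.le]
    refine max_le (mul_sqrt_norm_sum_star_mul_le_gns hφ.map_one hfree hx hx0 hδ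
      (fun i => (hxδ i).trans (min_le_left _ _)) s a) ?_
    -- The row bound is the column bound for the adjoint families `star (x i)`, `star (a i)`; here
    -- the lower bound on `φ (x i * star (x i))` enters.
    have h := mul_sqrt_norm_sum_star_mul_le_gns hφ.map_one hfree (x := fun i => star (x i))
      (fun i => star_mem (s := 𝒜 i) (hx i)) (fun i => by simp [map_star, hx0 i]) hδ
      (fun i => by simpa using (hxδ i).trans (min_le_right _ _)) s (fun i => star (a i))
    simp only [star_star, map_star] at h
    rwa [norm_sum_tensorOp_star] at h
  · refine (norm_sum_tensorOp_gns_le hφ.map_one hfree hdense hx hx1 hx0 s a).trans ?_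
    rw [two_mul]
    exact add_le_add (le_max_right _ _) (le_max_left _ _)

end Khintchine

/-! ### Restriction to the generated C*-subalgebra. -/

section Restriction

variable {I A B : Type*} [CStarAlgebra A] [PartialOrder A] [StarOrderedRing A]
  [CStarAlgebra B] [PartialOrder B] [StarOrderedRing B]

/-- The pullback of a positive linear functional along a star homomorphism. -/
noncomputable def pullbackFunctional (φ : A →ₚ[ℂ] ℂ) (j : B →⋆ₐ[ℂ] A) : B →ₚ[ℂ] ℂ :=
  PositiveLinearMap.mk₀ (φ.toLinearMap ∘ₗ j.toAlgHom.toLinearMap)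
    fun _ hb => φ.map_nonneg (map_nonneg j hb)

theorem pullbackFunctional_apply (φ : A →ₚ[ℂ] ℂ) (j : B →⋆ₐ[ℂ] A) (b : B) :
    pullbackFunctional φ j b = φ (j b) := rfl

theorem IsFaithfulState.pullback {φ : A →ₚ[ℂ] ℂ} (hφ : IsFaithfulState φ) {j : B →⋆ₐ[ℂ] A}
    (hj : Function.Injective j) : IsFaithfulState (pullbackFunctional φ j) where
  map_one := by rw [pullbackFunctional_apply, _root_.map_one, hφ.map_one]
  faithful b hb := hj (by
    rw [map_zero]
    exact hφ.faithful _ (by rwa [pullbackFunctional_apply, map_mul, map_star] at hb))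

theorem IsFreeFamily.pullback {φ : A →ₚ[ℂ] ℂ} {𝒜 : I → StarSubalgebra ℂ A}
    (hfree : IsFreeFamily φ 𝒜) (j : B →⋆ₐ[ℂ] A) :
    IsFreeFamily (pullbackFunctional φ j) fun i => (𝒜 i).comap j := by
  intro w hw hmem hchain
  have h := hfree (w.map fun p => (p.1, j p.2)) (by simpa using hw) (fun p hp => ?_) ?_
  · rw [pullbackFunctional_apply, map_list_prod]
    simpa [Function.comp_def] using h
  · obtain ⟨q, hq, rfl⟩ := List.mem_map.1 hp
    exact hmem q hq
  · exact (List.isChain_map _).2 hchain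

end Restriction

/-- The inclusion of `B` maps the subalgebra generated inside `B` onto the one generated in `A`,
whose closure is `B`. -/
theorem StarSubalgebra.dense_adjoin_comap_subtype {A : Type*} [CStarAlgebra A] {s : Set A}
    {B : StarSubalgebra ℂ A} (hB : B = (StarAlgebra.adjoin ℂ s).topologicalClosure) :
    Dense (StarAlgebra.adjoin ℂ (B.subtype ⁻¹' s) : Set B) := by
  intro b
  rw [closure_subtype]
  have hs : s ⊆ B := hB ▸ (StarAlgebra.subset_adjoin ℂ s).trans
    (StarSubalgebra.le_topologicalClosure _)
  have h : (Subtype.val '' (StarAlgebra.adjoin ℂ (B.subtype ⁻¹' s) : Set B)) =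
      (StarAlgebra.adjoin ℂ s : Set A) := by
    have := congrArg (SetLike.coe : StarSubalgebra ℂ A → Set A)
      (StarAlgHom.map_adjoin B.subtype (B.subtype ⁻¹' s))
    rw [Set.image_preimage_eq_of_subset (by simpa using hs)] at this
    exact this
  rw [h, ← StarSubalgebra.topologicalClosure_coe, ← hB]
  exact b.2

theorem proposition4p9 {I A H K : Type*}
    [CStarAlgebra A] [PartialOrder A] [StarOrderedRing A]
    [NormedAddCommGroup H] [InnerProductSpace ℂ H] [CompleteSpace H]
    [NormedAddCommGroup K] [InnerProductSpace ℂ K] [CompleteSpace K]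
    (φ : A →ₚ[ℂ] ℂ) (hφ : IsFaithfulState φ)
    (𝒜 : I → StarSubalgebra ℂ A) (h𝒜 : ∀ i, IsClosed (𝒜 i : Set A))
    (hfree : IsFreeFamily φ 𝒜)
    (δ : ℝ) (hδ : 0 < δ)
    (x : I → A) (hx : ∀ i, x i ∈ 𝒜 i) (hx1 : ∀ i, ‖x i‖ ≤ 1) (hx0 : ∀ i, φ (x i) = 0)
    (hxδ : ∀ i, δ ^ 2 ≤ min (φ (star (x i) * x i)).re (φ (x i * star (x i))).re)
    -- a faithful representation of `A`, which realizes the minimal tensor product with `B(H)`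
    (π : A →⋆ₐ[ℂ] (K →L[ℂ] K)) (hπ : Function.Injective π)
    (a : I →₀ (H →L[ℂ] H)) :
    δ * max √‖∑ i ∈ a.support, star (a i) * a i‖ √‖∑ i ∈ a.support, a i * star (a i)‖ ≤
        ‖∑ i ∈ a.support, tensorOp (π (x i)) (a i)‖ ∧
      ‖∑ i ∈ a.support, tensorOp (π (x i)) (a i)‖ ≤
        2 * max √‖∑ i ∈ a.support, star (a i) * a i‖
          √‖∑ i ∈ a.support, a i * star (a i)‖ := by
  -- The `𝒜 i` need not generate `A`, whereas the GNS argument needs alternating words to be dense.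
  -- Restricting `φ` and `π` to the generated C*-algebra preserves faithfulness and freeness and
  -- leaves the operators `π (x i)` unchanged.
  obtain ⟨B, hB⟩ : ∃ B : StarSubalgebra ℂ A,
      B = (StarAlgebra.adjoin ℂ (⋃ i, (𝒜 i : Set A))).topologicalClosure := ⟨_, rfl⟩
  have _ : IsClosed (B : Set A) := hB ▸ StarSubalgebra.isClosed_topologicalClosure _
  let _ : PartialOrder B := CStarAlgebra.spectralOrder B
  have _ : StarOrderedRing B := CStarAlgebra.spectralOrderedRing B
  have hxB (i : I) : x i ∈ B := hB ▸ StarSubalgebra.le_topologicalClosure _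
    (StarAlgebra.subset_adjoin ℂ _ (Set.mem_iUnion_of_mem i (hx i)))
  have hdense := StarSubalgebra.dense_adjoin_comap_subtype hB
  rw [Set.preimage_iUnion] at hdense
  exact khintchine_of_dense (hφ.pullback (j := B.subtype) Subtype.val_injective)
    (hfree.pullback B.subtype) hdense hδ (x := fun i => ⟨x i, hxB i⟩) hx hx1 hx0 hxδ
    (π := π.comp B.subtype) (hπ.comp Subtype.val_injective) a.support a
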